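/- Let $\Bbbk$ be a field and let $B$ be a $\Bbbk$-bialgebra with comultiplication $\Delta(b)=\sum b_1\otimes b_2$ and counit $\varepsilon$. Let $\mathfrak{M}$ be the category of $\Bbbk$-vector spaces and $\mathfrak{M}_B^B$ the category of right Hopf modules over $B$: vector spaces $M$ that are right $B$-modules and right $B$-comodules, with coaction $\rho_M(m)=\sum m_0\otimes m_1$, such that $\rho_M(mb)=\sum m_0b_1\otimes m_1b_2$ for all $m\in M$, $b\in B$; the morphisms are the $B$-linear $B$-colinear maps. Put $B^+=\ker\varepsilon$, and consider the functors $(-)^{\mathrm{co}B},\ \overline{(-)}^{B}:\mathfrak{M}_B^B\to\mathfrak{M}$ given by $$M^{\mathrm{co}B}=\{m\in M\mid \rho_M(m)=m\otimes 1_B\},\qquad \overline{M}^{B}=M/MB^+,$$ and the canonical natural transformation $\sigma:(-)^{\mathrm{co}B}\to\overline{(-)}^{B}$, $\sigma_M(m)=m+MB^+$. A functor $F:\mathcal{C}\to\mathcal{D}$ is called semiseparable if there is a natural transformation $\mathcal{P}:\mathrm{Hom}_{\mathcal{D}}(F-,F-)\to\mathrm{Hom}_{\mathcal{C}}(-,-)$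 such that $F(\mathcal{P}(F(f)))=F(f)$ for every morphism $f$ of $\mathcal{C}$. Then the following assertions are equivalent. 1. The functor $(-)^{\mathrm{co}B}:\mathfrak{M}_B^B\to\mathfrak{M}$ is semiseparable. 2. $B$ is a right Hopf algebra with anti-multiplicative and anti-comultiplicative right antipode; that is, there is a $\Bbbk$-linear map $S:B\to B$ such that $\sum b_1S(b_2)=\varepsilon(b)1_B$, $S(ab)=S(b)S(a)$ and $\Delta(S(b))=\sum S(b_2)\otimes S(b_1)$ for all $a,b\in B$. 3. The natural transformation $\sigma$ is invertible. 4. The natural transformation $\sigma$ is split-mono, that is, there is a natural transformation $\tau:\overline{(-)}^{B}\to(-)^{\mathrm{co}B}$ with $\tau\circ\sigma=\mathrm{Id}$. -/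

import Mathlib

open scoped TensorProduct
open CategoryTheory

universe w v u

/-- A functor `F : C ⥤ D` is semiseparable if the natural transformation
`Hom_C(-, -) ⟶ Hom_D(F -, F -)`, `f ↦ F f`, is regular: there is a natural transformation
`P : Hom_D(F -, F -) ⟶ Hom_C(-, -)` of functors `Cᵒᵖ × C ⥤ Type` with
`F (P (F f)) = F f` for all `f`. Naturality of `P` is the condition `P_natural`. -/
def CategoryTheory.Functor.IsSemiseparable {C : Type*} [Category C] {D : Type*} [Category D]
    (F : C ⥤ D) : Prop :=
  ∃ P : ∀ X Y : C, (F.obj X ⟶ F.obj Y) → (X ⟶ Y),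
    (∀ {X X' Y Y' : C} (f : X' ⟶ X) (g : F.obj X ⟶ F.obj Y) (h : Y ⟶ Y'),
      P X' Y' (F.map f ≫ g ≫ F.map h) = f ≫ P X Y g ≫ h) ∧
    ∀ {X Y : C} (f : X ⟶ Y), F.map (P X Y (F.map f)) = F.map f

noncomputable section

section Antipode

variable (k : Type u) [CommRing k] {B : Type v} [Ring B] [Bialgebra k B]

/-- `S` is a right antipode of `B`, i.e. a right convolution inverse of the identity:
`∑ b₁ S(b₂) = ε(b) 1`. -/
def IsRightAntipode (S : B →ₗ[k] B) : Prop :=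
  ∀ b : B, LinearMap.mul' k B (S.lTensor B (Coalgebra.comul (R := k) b)) =
    Coalgebra.counit (R := k) b • (1 : B)

/-- `S` is anti-multiplicative: `S(ab) = S(b) S(a)`. -/
def IsAntiMultiplicative (S : B →ₗ[k] B) : Prop :=
  ∀ a b : B, S (a * b) = S b * S a

/-- `S` is anti-comultiplicative: `Δ(S(b)) = ∑ S(b₂) ⊗ S(b₁)`. -/
def IsAntiComultiplicative (S : B →ₗ[k] B) : Prop :=
  ∀ b : B, Coalgebra.comul (R := k) (S b) =
    TensorProduct.map S S (TensorProduct.comm k B B (Coalgebra.comul (R := k) b))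

end Antipode

section HopfModules

variable (k : Type u) [CommRing k] (B : Type v) [Ring B] [Bialgebra k B]

/-- A right Hopf module over the bialgebra `B`: a `k`-module `M` which is a right `B`-module
(`act m b` is `m b`) and a right `B`-comodule (with coaction `coact`, written `ρ`), such that
`ρ(m b) = ρ(m) Δ(b) = ∑ m₀ b₁ ⊗ m₁ b₂`. -/
structure RightHopfModule where
  /-- the underlying type -/
  carrier : Type w
  [addCommGroup : AddCommGroup carrier]
  [module : Module k carrier]
  /-- the right action `m ↦ b ↦ m b` -/
  act : carrier →ₗ[k] B →ₗ[k] carrier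
  act_one : ∀ m, act m 1 = m
  act_mul : ∀ m a b, act m (a * b) = act (act m a) b
  /-- the right coaction `ρ` -/
  coact : carrier →ₗ[k] carrier ⊗[k] B
  coact_coassoc : ∀ m, TensorProduct.assoc k carrier B B (coact.rTensor B (coact m)) =
    (Coalgebra.comul (R := k) (A := B)).lTensor carrier (coact m)
  coact_counit : ∀ m, TensorProduct.rid k carrier
    ((Coalgebra.counit (R := k) (A := B)).lTensor carrier (coact m)) = m
  coact_act : ∀ m b, coact (act m b) =
    TensorProduct.map₂ act (LinearMap.mul k B) (coact m) (Coalgebra.comul (R := k) b)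

namespace RightHopfModule

attribute [instance] addCommGroup module

variable {k B}

/-- Morphisms of right Hopf modules: `k`-linear maps that are `B`-linear and `B`-colinear. -/
@[ext]
structure Hom (M N : RightHopfModule.{w} k B) where
  /-- the underlying linear map -/
  toLin : M.carrier →ₗ[k] N.carrier
  map_act : ∀ m b, toLin (M.act m b) = N.act (toLin m) b
  map_coact : ∀ m, N.coact (toLin m) = toLin.rTensor B (M.coact m)

instance : Category (RightHopfModule.{w} k B) where
  Hom M N := Hom M N
  id M :=
    { toLin := LinearMap.id
      map_act := fun _ _ => rfl
      map_coact := fun m => by simp }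
  comp f g :=
    { toLin := g.toLin ∘ₗ f.toLin
      map_act := fun m b => by simp [f.map_act, g.map_act]
      map_coact := fun m => by
        simp only [LinearMap.comp_apply, LinearMap.rTensor_comp, g.map_coact, f.map_coact] }

@[ext]
theorem hom_ext {M N : RightHopfModule.{w} k B} {f g : M ⟶ N} (h : f.toLin = g.toLin) : f = g :=
  Hom.ext h

@[simp]
theorem id_toLin (M : RightHopfModule.{w} k B) : Hom.toLin (𝟙 M) = LinearMap.id := rfl

@[simp]
theorem comp_toLin {M N P : RightHopfModule.{w} k B} (f : M ⟶ N) (g : N ⟶ P) :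
    (f ≫ g).toLin = g.toLin ∘ₗ f.toLin := rfl

/-- The coinvariants `M^{co B} = {m | ρ(m) = m ⊗ 1}`. -/
def coinvariants (M : RightHopfModule.{w} k B) : Submodule k M.carrier :=
  LinearMap.eqLocus M.coact ((TensorProduct.mk k M.carrier B).flip 1)

theorem mem_coinvariants (M : RightHopfModule.{w} k B) (m : M.carrier) :
    m ∈ M.coinvariants ↔ M.coact m = m ⊗ₜ[k] (1 : B) := Iff.rfl

/-- The subspace `M B⁺` spanned by the elements `m b` with `m ∈ M` and `b ∈ B⁺ = ker ε`. -/
def actAugmentation (M : RightHopfModule.{w} k B) : Submodule k M.carrier :=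
  Submodule.map₂ M.act ⊤ (LinearMap.ker (Coalgebra.counit (R := k) (A := B)))

theorem Hom.mem_coinvariants {M N : RightHopfModule.{w} k B} (f : M ⟶ N) :
    ∀ m ∈ M.coinvariants, f.toLin m ∈ N.coinvariants := by
  intro m hm
  rw [RightHopfModule.mem_coinvariants] at hm ⊢
  rw [f.map_coact, hm, LinearMap.rTensor_tmul]

theorem Hom.actAugmentation_le {M N : RightHopfModule.{w} k B} (f : M ⟶ N) :
    M.actAugmentation ≤ N.actAugmentation.comap f.toLin := by
  refine Submodule.map₂_le.2 fun m _ b hb => ?_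
  rw [Submodule.mem_comap, f.map_act]
  exact Submodule.apply_mem_map₂ _ Submodule.mem_top hb

variable (k B)

/-- The coinvariant functor `(-)^{co B}` from right Hopf modules to `k`-modules. -/
def coinvariantsFunctor : RightHopfModule.{w} k B ⥤ ModuleCat.{w} k where
  obj M := ModuleCat.of k M.coinvariants
  map f := ModuleCat.ofHom (f.toLin.restrict (Hom.mem_coinvariants f))
  map_id _ := rfl
  map_comp _ _ := rfl

/-- The functor `M ↦ M / M B⁺` from right Hopf modules to `k`-modules. -/
def quotientFunctor : RightHopfModule.{w} k B ⥤ ModuleCat.{w} k where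
  obj M := ModuleCat.of k (M.carrier ⧸ M.actAugmentation)
  map {M N} f := ModuleCat.ofHom
    (Submodule.mapQ M.actAugmentation N.actAugmentation f.toLin (Hom.actAugmentation_le f))
  map_id M := by
    ext x
    rfl
  map_comp f g := by
    ext x
    rfl

/-- The canonical natural transformation `σ : (-)^{co B} ⟶ (-)/(-)B⁺`, `σ_M(m) = m + M B⁺`. -/
def sigma : coinvariantsFunctor.{w} k B ⟶ quotientFunctor.{w} k B where
  app M := ModuleCat.ofHom (M.actAugmentation.mkQ ∘ₗ M.coinvariants.subtype)
  naturality _ _ _ := rfl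

end RightHopfModule

end HopfModules

end

/-! In Sweedler notation, everything passes through two identities for a linear map `S` with S(1) =
1: (A) ∑ c₁ S(b c₂) = ε(c) S(b), and (B) ∑ S(b₂)₁ ⊗ b₁ S(b₂)₂ = S(b) ⊗ 1. Together they are
equivalent to `S` being a right antipode that reverses products and coproducts. They say exactly
what is needed for m ↦ ∑ m₀ S(m₁) to be a projection of every Hopf module onto its coinvariants that
factors through M / MB⁺: (B) puts the image in the coinvariants, (A) kills MB⁺, and S(1) = 1 fixes
the coinvariants. Since also ε ∘ S = ε, this map inverts `sigma`.

Conversely, the notion linking all four conditions is a natural family of such projections T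
(`CoinvariantProjection`). A retraction of `sigma` is one. Semiseparability gives one by lifting m ↦
m ⊗ 1 to a morphism M ⟶ M^{co B} ⊗ B and applying ε. Naturality forces T(m) = ∑ m₀ S(m₁) for one
universal `S` (`toLin_apply`), and testing T on two Hopf module structures on B ⊗ B yields (A) and
(B). Finally, T turns a linear map g between coinvariants into the morphism m ↦ ∑ g(T(m₀)) m₁, which
restricts to g (`extend_coe`), hence semiseparability. -/

noncomputable section

/-! ### Test objects: Hopf modules on tensor products -/

namespace RightHopfModule

variable {k : Type u} [CommRing k] {B : Type v} [Ring B] [Bialgebra k B]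

/-- The Hopf module `N ⊗ B` attached to a right `B`-module `N`, with action
`(n ⊗ b) c = ∑ n c₁ ⊗ b c₂` and coaction `n ⊗ b ↦ ∑ n ⊗ b₁ ⊗ b₂`. -/
abbrev cofree (N : Type v) [AddCommGroup N] [Module k N] (act : N →ₗ[k] B →ₗ[k] N)
    (act_one : ∀ n, act n 1 = n) (act_mul : ∀ n a b, act n (a * b) = act (act n a) b) :
    RightHopfModule.{v} k B where
  carrier := N ⊗[k] B
  act := (TensorProduct.map₂ act (LinearMap.mul k B)).compl₂ Coalgebra.comul
  act_one m := by
    induction m with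
    | zero => simp
    | add x y hx hy => rw [map_add, LinearMap.add_apply, hx, hy]
    | tmul n b => simp [Algebra.TensorProduct.one_def, act_one]
  act_mul m a b := by
    induction m with
    | zero => simp
    | add x y hx hy => simp only [map_add, LinearMap.add_apply, hx, hy]
    | tmul n c =>
      simp only [LinearMap.compl₂_apply, Bialgebra.comul_mul]
      -- Both sides are linear in each coproduct separately, so arbitrary tensors may replace them;
      -- the same device recurs throughout.
      generalize Coalgebra.comul (R := k) a = s
      generalize Coalgebra.comul (R := k) b = t
      induction s with
      | zero => simp
      | add x y hx hy => simp only [add_mul, map_add, LinearMap.add_apply, hx, hy]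
      | tmul a₁ a₂ =>
        induction t with
        | zero => simp
        | add x y hx hy => simp only [mul_add, map_add, hx, hy]
        | tmul b₁ b₂ => simp [act_mul, mul_assoc]
  coact := (TensorProduct.assoc k N B B).symm.toLinearMap ∘ₗ Coalgebra.comul.lTensor N
  coact_coassoc m := by
    induction m with
    | zero => simp
    | add x y hx hy => simp only [map_add, hx, hy]
    | tmul n b =>
      have h := congrArg (fun t => (TensorProduct.assoc k N B (B ⊗[k] B)).symm (n ⊗ₜ[k] t))
        (Coalgebra.coassoc_apply (R := k) b)
      simp only [LinearMap.comp_apply, LinearMap.lTensor_tmul, LinearEquiv.coe_coe] at h ⊢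
      generalize Coalgebra.comul (R := k) b = t at h ⊢
      refine Eq.trans ?_ (h.trans ?_)
      · clear h
        induction t with
        | zero => simp
        | add x y hx hy => simp only [map_add, TensorProduct.tmul_add, hx, hy]
        | tmul b₁ b₂ =>
          simp only [TensorProduct.assoc_symm_tmul, LinearMap.rTensor_tmul, LinearMap.comp_apply,
            LinearMap.lTensor_tmul, LinearEquiv.coe_coe]
          generalize Coalgebra.comul (R := k) b₁ = t
          induction t with
          | zero => simp
          | add x y hx hy => simp only [map_add, TensorProduct.tmul_add, TensorProduct.add_tmul, hx, hy]
          | tmul b₁ b₂ => simp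
      · clear h
        induction t with
        | zero => simp
        | add x y hx hy => simp only [map_add, TensorProduct.tmul_add, hx, hy]
        | tmul b₁ b₂ => simp
  coact_counit m := by
    induction m with
    | zero => simp
    | add x y hx hy => simp only [map_add, hx, hy]
    | tmul n b =>
      have h := congrArg (fun t => n ⊗ₜ[k] TensorProduct.rid k B t)
        (Coalgebra.lTensor_counit_comul (R := k) b)
      simp only [LinearMap.comp_apply, LinearMap.lTensor_tmul, LinearEquiv.coe_coe] at h ⊢
      generalize Coalgebra.comul (R := k) b = t at h ⊢
      refine Eq.trans ?_ (h.trans (by simp))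
      clear h
      induction t with
      | zero => simp
      | add x y hx hy => simp only [map_add, TensorProduct.tmul_add, hx, hy]
      | tmul b₁ b₂ => simp
  coact_act m c := by
    induction m with
    | zero => simp
    | add x y hx hy => simp only [map_add, LinearMap.add_apply, hx, hy]
    | tmul n b =>
      -- Both sides are ∑ n c₁ ⊗ Δ(b)(c₂ ⊗ c₃), read through the two bracketings of the iterated
      -- coproduct of `c`.
      have h := congrArg
        ((TensorProduct.assoc k N B B).symm.toLinearMap ∘ₗ TensorProduct.map (act n)
          (LinearMap.mulLeft k (Coalgebra.comul (R := k) b)))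
        (Coalgebra.coassoc_apply (R := k) c)
      simp only [LinearMap.comp_apply, LinearMap.compl₂_apply, LinearEquiv.coe_coe,
        LinearMap.lTensor_tmul] at h ⊢
      generalize Coalgebra.comul (R := k) c = t at h ⊢
      refine Eq.trans ?_ (h.symm.trans ?_)
      · clear h
        induction t with
        | zero => simp
        | add x y hx hy => simp only [map_add, hx, hy]
        | tmul b₁ b₂ => simp
      · clear h
        induction t with
        | zero => simp
        | add x y hx hy => simp only [map_add, hx, hy]
        | tmul c₁ c₂ =>
          generalize Coalgebra.comul (R := k) b = s
          simp only [LinearMap.rTensor_tmul]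
          induction s with
          | zero => simp
          | add x y hx hy =>
            simp only [map_add, TensorProduct.tmul_add, LinearMap.add_apply, ← hx, ← hy]
            rw [show LinearMap.mulLeft k (x + y) = LinearMap.mulLeft k x + LinearMap.mulLeft k y by
              ext; simp [add_mul], TensorProduct.map_add_right]
            simp
          | tmul b₁ b₂ =>
            simp only [TensorProduct.assoc_symm_tmul, TensorProduct.map₂_apply_tmul,
              TensorProduct.map_tmul, LinearMap.compl₂_apply]
            generalize Coalgebra.comul (R := k) c₁ = t
            induction t with
            | zero => simp
            | add x y hx hy => simp only [map_add, TensorProduct.add_tmul, hx, hy]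
            | tmul b₁ b₂ => simp

/-- The Hopf module `B ⊗ B` with action `(v ⊗ b) c = v ⊗ b c` and coaction
`v ⊗ b ↦ ∑ v₁ ⊗ b₁ ⊗ v₂ b₂`. -/
abbrev codiagonal (k : Type u) [CommRing k] (B : Type v) [Ring B] [Bialgebra k B] :
    RightHopfModule.{v} k B where
  carrier := B ⊗[k] B
  act := LinearMap.flip (LinearMap.lTensorHom B ∘ₗ (LinearMap.mul k B).flip)
  act_one m := by
    induction m with
    | zero => simp
    | add x y hx hy => rw [map_add, LinearMap.add_apply, hx, hy]
    | tmul n b => simp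
  act_mul m a b := by
    induction m with
    | zero => simp
    | add x y hx hy => simp only [map_add, LinearMap.add_apply, hx, hy]
    | tmul n c => simp [mul_assoc]
  coact := TensorProduct.lift ((TensorProduct.map₂ (TensorProduct.mk k B B)
    (LinearMap.mul k B)).compl₁₂ Coalgebra.comul Coalgebra.comul)
  coact_coassoc m := by
    induction m with
    | zero => simp
    | add x y hx hy => simp only [map_add, hx, hy]
    | tmul v b =>
      have hv := Coalgebra.coassoc_apply (R := k) v
      have hb := Coalgebra.coassoc_apply (R := k) b
      simp only [TensorProduct.lift.tmul, LinearMap.compl₁₂_apply]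
      -- Coassociativity of `v` and of `b` are combined, multiplying the last two tensor factors;
      -- this is the required identity since Δ is multiplicative.
      have key := congrArg₂ (fun s t => TensorProduct.map₂ (TensorProduct.mk k B B)
        (LinearMap.mul k (B ⊗[k] B)) s t) hv hb
      beta_reduce at key
      generalize Coalgebra.comul (R := k) v = s at key ⊢
      generalize Coalgebra.comul (R := k) b = t at key ⊢
      refine Eq.trans ?_ (key.trans ?_) <;> clear key
      · induction s with
        | zero => simp
        | add x y hx hy => simp only [map_add, LinearMap.add_apply, hx, hy]
        | tmul v₁ v₂ =>
          induction t with
          | zero => simp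
          | add x y hx hy => simp only [map_add, hx, hy]
          | tmul b₁ b₂ =>
            simp only [TensorProduct.map₂_apply_tmul, TensorProduct.map_tmul, LinearMap.rTensor_tmul,
              TensorProduct.lift.tmul, LinearMap.compl₁₂_apply, TensorProduct.mk_apply]
            generalize Coalgebra.comul (R := k) v₁ = s
            generalize Coalgebra.comul (R := k) b₁ = t
            induction s with
            | zero => simp
            | add x y hx hy =>
              simp only [map_add, LinearMap.add_apply, TensorProduct.add_tmul, hx, hy]
            | tmul v₁ v₂ =>
              induction t with
              | zero => simp
              | add x y hx hy =>  simp only [map_add, TensorProduct.add_tmul, hx, hy]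
              | tmul b₁ b₂ => simp
      · induction s with
        | zero => simp
        | add x y hx hy => simp only [map_add, LinearMap.add_apply, hx, hy]
        | tmul v₁ v₂ =>
          induction t with
          | zero => simp
          | add x y hx hy => simp only [map_add, hx, hy]
          | tmul b₁ b₂ => simp
  coact_counit m := by
    induction m with
    | zero => simp
    | add x y hx hy => simp only [map_add, hx, hy]
    | tmul v b =>
      have key := congrArg₂ (fun s t => TensorProduct.map₂ (TensorProduct.mk k B B)
        (LinearMap.mul k k) s t) (Coalgebra.lTensor_counit_comul (R := k) v)
        (Coalgebra.lTensor_counit_comul (R := k) b)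
      have key := congrArg (TensorProduct.rid k (B ⊗[k] B)) key
      simp only [TensorProduct.lift.tmul, LinearMap.compl₁₂_apply] at key ⊢
      generalize Coalgebra.comul (R := k) v = s at key ⊢
      generalize Coalgebra.comul (R := k) b = t at key ⊢
      refine Eq.trans ?_ (key.trans (by simp))
      clear key
      induction s with
      | zero => simp
      | add x y hx hy => simp only [map_add, LinearMap.add_apply, hx, hy]
      | tmul v₁ v₂ =>
        induction t with
        | zero => simp
        | add x y hx hy => simp only [map_add, hx, hy]
        | tmul b₁ b₂ => simp
  coact_act m c := by
    induction m with
    | zero => simp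
    | add x y hx hy => simp only [map_add, LinearMap.add_apply, hx, hy]
    | tmul v b =>
      change TensorProduct.map₂ (TensorProduct.mk k B B) (LinearMap.mul k B)
          (Coalgebra.comul v) (Coalgebra.comul (b * c)) =
        TensorProduct.map₂ _ _ (TensorProduct.map₂ (TensorProduct.mk k B B) (LinearMap.mul k B)
          (Coalgebra.comul v) (Coalgebra.comul b)) (Coalgebra.comul c)
      rw [Bialgebra.comul_mul]
      generalize Coalgebra.comul (R := k) v = s
      generalize Coalgebra.comul (R := k) b = t
      generalize Coalgebra.comul (R := k) c = r
      induction s with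
      | zero => simp
      | add x y hx hy => simp only [map_add, LinearMap.add_apply, hx, hy]
      | tmul v₁ v₂ =>
        induction t with
        | zero => simp
        | add x y hx hy => simp only [add_mul, map_add, LinearMap.add_apply, hx, hy]
        | tmul b₁ b₂ =>
          induction r with
          | zero => simp
          | add x y hx hy => simp only [mul_add, map_add, hx, hy]
          | tmul c₁ c₂ => simp [mul_assoc]

end RightHopfModule

/-! ### Identities (A) and (B) versus the antipode axioms -/

section Antipode

variable {k : Type u} [CommRing k] {B : Type v} [Ring B] [Bialgebra k B]

/-- The map `x ⊗ y ↦ ∑ S(y)₁ ⊗ x S(y)₂`. -/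
def antipodeTwist (S : B →ₗ[k] B) : B ⊗[k] B →ₗ[k] B ⊗[k] B :=
  TensorProduct.lift
    ((LinearMap.lTensorHom B ∘ₗ LinearMap.mul k B).compl₂ (Coalgebra.comul ∘ₗ S))

theorem antipodeTwist_tmul (S : B →ₗ[k] B) (x y : B) :
    antipodeTwist S (x ⊗ₜ[k] y) =
      (LinearMap.mulLeft k x).lTensor B (Coalgebra.comul (R := k) (S y)) := rfl

/-- The map `c₁ ⊗ c₂ ↦ c₁ S(b c₂)`. -/
def mulAntipodeMul (S : B →ₗ[k] B) (b : B) : B ⊗[k] B →ₗ[k] B :=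
  TensorProduct.lift ((LinearMap.mul k B).compl₂ (S ∘ₗ LinearMap.mulLeft k b))

@[simp]
theorem mulAntipodeMul_tmul (S : B →ₗ[k] B) (b x y : B) :
    mulAntipodeMul S b (x ⊗ₜ[k] y) = x * S (b * y) := rfl

theorem IsRightAntipode.map_one {S : B →ₗ[k] B} (hS : IsRightAntipode k S) : S 1 = 1 := by
  simpa [Algebra.TensorProduct.one_def] using hS 1

/-- Apply ε to ∑ b₁ S(b₂) = ε(b) 1: the left side becomes ε(S(∑ ε(b₁) b₂)). -/
theorem IsRightAntipode.counit_apply {S : B →ₗ[k] B} (hS : IsRightAntipode k S) (b : B) :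
    Coalgebra.counit (R := k) (S b) = Coalgebra.counit (R := k) b := by
  have h := congrArg (Coalgebra.counit (R := k)) (hS b)
  have h₂ := congrArg (fun t => Coalgebra.counit (R := k) (S (TensorProduct.lid k B t)))
    (Coalgebra.rTensor_counit_comul (R := k) b)
  have h₃ : Coalgebra.counit ∘ₗ LinearMap.mul' k B ∘ₗ S.lTensor B =
      Coalgebra.counit ∘ₗ S ∘ₗ (TensorProduct.lid k B).toLinearMap ∘ₗ
        Coalgebra.counit.rTensor B := TensorProduct.ext' fun x y => by simp
  have h₄ := LinearMap.congr_fun h₃ (Coalgebra.comul b)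
  simp only [LinearMap.comp_apply, LinearEquiv.coe_coe] at h₄
  rw [h₄] at h
  simpa [h₂] using h

/-- A right antipode that is anti-multiplicative satisfies `∑ c₁ S(b c₂) = ε(c) S(b)`. -/
theorem IsRightAntipode.mulAntipodeMul_comul {S : B →ₗ[k] B} (hS : IsRightAntipode k S)
    (hm : IsAntiMultiplicative k S) (b c : B) :
    mulAntipodeMul S b (Coalgebra.comul (R := k) c) = Coalgebra.counit (R := k) c • S b := by
  have h : mulAntipodeMul S b =
      LinearMap.mulRight k (S b) ∘ₗ LinearMap.mul' k B ∘ₗ S.lTensor B :=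
    TensorProduct.ext' fun x y => by simp [hm b y, mul_assoc]
  rw [h, LinearMap.comp_apply, LinearMap.comp_apply, hS c]
  simp

/-- A right antipode that is anti-comultiplicative satisfies
`∑ S(b₂)₁ ⊗ b₁ S(b₂)₂ = S(b) ⊗ 1`. -/
theorem IsRightAntipode.antipodeTwist_comul {S : B →ₗ[k] B} (hS : IsRightAntipode k S)
    (hc : IsAntiComultiplicative k S) (b : B) :
    antipodeTwist S (Coalgebra.comul (R := k) b) = S b ⊗ₜ[k] 1 := by
  -- `F` sends x ⊗ y ⊗ z to S(z) ⊗ x S(y). Reversing Δ(S(b₂)) turns the twist into ∑ S(b₃) ⊗ b₁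
  -- S(b₂), where coassociativity exposes the antipode axiom.
  let F : B ⊗[k] (B ⊗[k] B) →ₗ[k] B ⊗[k] B :=
    (TensorProduct.comm k B B).toLinearMap ∘ₗ
      TensorProduct.map (LinearMap.mul' k B ∘ₗ S.lTensor B) S ∘ₗ
        (TensorProduct.assoc k B B B).symm.toLinearMap
  have h₁ : antipodeTwist S = F ∘ₗ Coalgebra.comul.lTensor B := by
    refine TensorProduct.ext' fun x y => ?_
    rw [antipodeTwist_tmul, hc y, LinearMap.comp_apply, LinearMap.lTensor_tmul]
    generalize Coalgebra.comul (R := k) y = t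
    induction t with
    | zero => simp
    | add s t hs ht => simp only [map_add, TensorProduct.tmul_add, hs, ht]
    | tmul u v => simp [F]
  rw [h₁, LinearMap.comp_apply, ← Coalgebra.coassoc_apply]
  have h₂ : F ∘ₗ (TensorProduct.assoc k B B B).toLinearMap ∘ₗ Coalgebra.comul.rTensor B =
      (TensorProduct.comm k B B).toLinearMap ∘ₗ
        TensorProduct.map (Algebra.linearMap k B) S ∘ₗ Coalgebra.counit.rTensor B :=
    TensorProduct.ext' fun x y => by
      simp only [F, LinearMap.comp_apply, LinearMap.rTensor_tmul, LinearEquiv.coe_coe,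
        LinearEquiv.symm_apply_apply, TensorProduct.map_tmul, hS x]
      simp [Algebra.algebraMap_eq_smul_one]
  have h₃ := LinearMap.congr_fun h₂ (Coalgebra.comul b)
  simp only [LinearMap.comp_apply, LinearEquiv.coe_coe] at h₃
  rw [h₃, Coalgebra.rTensor_counit_comul]
  simp

theorem isRightAntipode_of_mulAntipodeMul {S : B →ₗ[k] B} (h1 : S 1 = 1)
    (h : ∀ b c : B, mulAntipodeMul S b (Coalgebra.comul (R := k) c) =
      Coalgebra.counit (R := k) c • S b) : IsRightAntipode k S := by
  intro b
  have h₂ : LinearMap.mul' k B ∘ₗ S.lTensor B = mulAntipodeMul S 1 :=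
    TensorProduct.ext' fun x y => by simp
  rw [← LinearMap.comp_apply, h₂, h, h1]

/-- Evaluate ∑ S(c₂)₁ S(b c₁ S(c₂)₂) in two ways. By (A), with b c₁ and S(c₂) as arguments, it is ∑
ε(S(c₂)) S(b c₁) = S(bc); by (B) it is S(c) S(b). -/
theorem isAntiMultiplicative_of_antipodeTwist {S : B →ₗ[k] B} (hS : IsRightAntipode k S)
    (h : ∀ b c : B, mulAntipodeMul S b (Coalgebra.comul (R := k) c) =
      Coalgebra.counit (R := k) c • S b)
    (h' : ∀ b : B, antipodeTwist S (Coalgebra.comul (R := k) b) = S b ⊗ₜ[k] 1) :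
    IsAntiMultiplicative k S := by
  intro b c
  have h₁ : mulAntipodeMul S b ∘ₗ antipodeTwist S =
      (S ∘ₗ LinearMap.mulLeft k b) ∘ₗ (TensorProduct.rid k B).toLinearMap ∘ₗ
        Coalgebra.counit.lTensor B := by
    refine TensorProduct.ext' fun x y => ?_
    have h₂ : mulAntipodeMul S b ∘ₗ (LinearMap.mulLeft k x).lTensor B =
      mulAntipodeMul S (b * x) := TensorProduct.ext' fun u v => by simp [mul_assoc]
    rw [LinearMap.comp_apply, antipodeTwist_tmul, ← LinearMap.comp_apply, h₂, h,
      hS.counit_apply]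
    simp
  have h₃ := LinearMap.congr_fun h₁ (Coalgebra.comul c)
  rw [LinearMap.comp_apply, h'] at h₃
  simpa using h₃.symm

/-- Apply u ⊗ v ↦ ∑ u₁ ⊗ u₂ S(v) to both sides of (B). The right side gives Δ(S(b)) because S(1) =
1; on the left, coassociativity and (A) collapse the sum to ∑ S(b₂) ⊗ S(b₁). -/
theorem isAntiComultiplicative_of_antipodeTwist {S : B →ₗ[k] B} (hS : IsRightAntipode k S)
    (h : ∀ b c : B, mulAntipodeMul S b (Coalgebra.comul (R := k) c) =
      Coalgebra.counit (R := k) c • S b)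
    (h' : ∀ b : B, antipodeTwist S (Coalgebra.comul (R := k) b) = S b ⊗ₜ[k] 1) :
    IsAntiComultiplicative k S := by
  intro b
  let F : B ⊗[k] B →ₗ[k] B ⊗[k] B :=
    (LinearMap.mul' k B ∘ₗ S.lTensor B).lTensor B ∘ₗ
      (TensorProduct.assoc k B B B).toLinearMap ∘ₗ Coalgebra.comul.rTensor B
  have h₁ : F ∘ₗ antipodeTwist S =
      TensorProduct.map S S ∘ₗ (TensorProduct.comm k B B).toLinearMap := by
    refine TensorProduct.ext' fun x y => ?_
    rw [LinearMap.comp_apply, antipodeTwist_tmul]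
    have h₂ : F ∘ₗ (LinearMap.mulLeft k x).lTensor B = (mulAntipodeMul S x).lTensor B ∘ₗ
        (TensorProduct.assoc k B B B).toLinearMap ∘ₗ Coalgebra.comul.rTensor B := by
      refine TensorProduct.ext' fun u v => ?_
      simp only [F, LinearMap.comp_apply, LinearMap.rTensor_tmul, LinearMap.lTensor_tmul]
      generalize Coalgebra.comul (R := k) u = t
      induction t with
      | zero => simp
      | add s t hs ht => simp only [map_add, TensorProduct.add_tmul, hs, ht]
      | tmul u₁ u₂ => simp
    have h₃ : (mulAntipodeMul S x).lTensor B ∘ₗ Coalgebra.comul.lTensor B =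
        (LinearMap.toSpanSingleton k B (S x)).lTensor B ∘ₗ Coalgebra.counit.lTensor B :=
      TensorProduct.ext' fun u v => by simp [h]
    rw [← LinearMap.comp_apply, h₂, LinearMap.comp_apply, LinearMap.comp_apply,
      LinearEquiv.coe_coe, Coalgebra.coassoc_apply, ← LinearMap.comp_apply, h₃,
      LinearMap.comp_apply, Coalgebra.lTensor_counit_comul]
    simp
  have h₄ := LinearMap.congr_fun h₁ (Coalgebra.comul b)
  rw [LinearMap.comp_apply, h'] at h₄
  refine Eq.trans ?_ h₄
  simp only [F, LinearMap.comp_apply, LinearMap.rTensor_tmul]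
  generalize Coalgebra.comul (R := k) (S b) = t
  induction t with
  | zero => simp
  | add s t hs ht => rw [TensorProduct.add_tmul, map_add, map_add, ← hs, ← ht]
  | tmul u₁ u₂ => simp [hS.map_one]

end Antipode

/-! ### From an antipode to the inverse of `sigma` -/

namespace RightHopfModule

variable {k : Type u} [CommRing k] {B : Type v} [Ring B] [Bialgebra k B]

/-- The map `M ⊗ B → M`, `m ⊗ b ↦ m S(b)`. -/
def actAntipode (M : RightHopfModule.{w} k B) (S : B →ₗ[k] B) : M.carrier ⊗[k] B →ₗ[k] M.carrier :=
  TensorProduct.lift (M.act.compl₂ S)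

@[simp]
theorem actAntipode_tmul (M : RightHopfModule.{w} k B) (S : B →ₗ[k] B) (m : M.carrier) (b : B) :
    M.actAntipode S (m ⊗ₜ[k] b) = M.act m (S b) := rfl

/-- Compatibility of action and coaction gives ρ(∑ m₀ S(m₁)) = ∑ m₀ S(m₂)₁ ⊗ m₁ S(m₂)₂, to which (B)
applies. -/
theorem actAntipode_coact_mem_coinvariants (M : RightHopfModule.{w} k B) {S : B →ₗ[k] B}
    (h : ∀ b : B, antipodeTwist S (Coalgebra.comul (R := k) b) = S b ⊗ₜ[k] 1) (m : M.carrier) :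
    M.actAntipode S (M.coact m) ∈ M.coinvariants := by
  rw [mem_coinvariants]
  let F : M.carrier ⊗[k] B ⊗[k] B →ₗ[k] M.carrier ⊗[k] B :=
    TensorProduct.lift ((TensorProduct.map₂ M.act (LinearMap.mul k B)).compl₂
      (Coalgebra.comul ∘ₗ S))
  have h₁ : M.coact ∘ₗ M.actAntipode S = F ∘ₗ M.coact.rTensor B :=
    TensorProduct.ext' fun n b => by simp [F, M.coact_act]
  have h₂ : F ∘ₗ (TensorProduct.assoc k M.carrier B B).symm.toLinearMap ∘ₗ
      Coalgebra.comul.lTensor M.carrier =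
        (TensorProduct.mk k M.carrier B).flip 1 ∘ₗ M.actAntipode S := by
    refine TensorProduct.ext' fun n b => ?_
    have h₃ := congrArg ((M.act n).rTensor B) (h b)
    simp only [LinearMap.comp_apply, LinearMap.lTensor_tmul, LinearMap.rTensor_tmul] at h₃ ⊢
    refine Eq.trans ?_ h₃
    generalize Coalgebra.comul (R := k) b = t
    induction t with
    | zero => simp
    | add s t hs ht => simp only [map_add, TensorProduct.tmul_add, hs, ht]
    | tmul x y =>
      simp only [F, LinearEquiv.coe_coe, TensorProduct.assoc_symm_tmul, TensorProduct.lift.tmul,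
        LinearMap.compl₂_apply, TensorProduct.map₂_apply_tmul, antipodeTwist_tmul,
        LinearMap.comp_apply]
      generalize Coalgebra.comul (R := k) (S y) = t
      induction t with
      | zero => simp
      | add s t hs ht => simp only [map_add, hs, ht]
      | tmul x y => simp
  have h₄ := (LinearEquiv.eq_symm_apply _).2 (M.coact_coassoc m)
  have h₅ := LinearMap.congr_fun h₁ (M.coact m)
  have h₆ := LinearMap.congr_fun h₂ (M.coact m)
  simp only [LinearMap.comp_apply, LinearEquiv.coe_coe] at h₅ h₆
  rw [h₅, h₄, h₆]
  simp

/-- The left side is ∑ m₀ b₁ S(m₁ b₂), to which (A) applies. -/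
theorem actAntipode_coact_act (M : RightHopfModule.{w} k B) {S : B →ₗ[k] B}
    (h : ∀ b c : B, mulAntipodeMul S b (Coalgebra.comul (R := k) c) =
      Coalgebra.counit (R := k) c • S b) (m : M.carrier) (b : B) :
    M.actAntipode S (M.coact (M.act m b)) =
      Coalgebra.counit (R := k) b • M.actAntipode S (M.coact m) := by
  rw [M.coact_act]
  generalize M.coact m = t
  induction t with
  | zero => simp
  | add s t hs ht => simp only [map_add, LinearMap.add_apply, smul_add, hs, ht]
  | tmul n c =>
    have h₁ : M.actAntipode S ∘ₗ TensorProduct.map₂ M.act (LinearMap.mul k B) (n ⊗ₜ[k] c) =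
        M.act n ∘ₗ mulAntipodeMul S c :=
      TensorProduct.ext' fun x y => by simp [M.act_mul]
    rw [← LinearMap.comp_apply, h₁, LinearMap.comp_apply, h]
    simp

theorem actAntipode_coact_of_mem_coinvariants (M : RightHopfModule.{w} k B) {S : B →ₗ[k] B}
    (h : S 1 = 1) {m : M.carrier} (hm : m ∈ M.coinvariants) :
    M.actAntipode S (M.coact m) = m := by
  rw [(M.mem_coinvariants m).1 hm, actAntipode_tmul, h, M.act_one]

theorem act_sub_counit_smul_mem (M : RightHopfModule.{w} k B) (m : M.carrier) (b : B) :
    M.act m b - Coalgebra.counit (R := k) b • m ∈ M.actAugmentation := by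
  have h := Submodule.apply_mem_map₂ M.act (Submodule.mem_top (x := m))
    (show b - Coalgebra.counit (R := k) b • (1 : B) ∈
      LinearMap.ker (Coalgebra.counit (R := k) (A := B)) by simp)
  simp only [map_sub, map_smul, M.act_one] at h
  exact h

/-- Modulo MB⁺ an element of `B` acts through ε, so ∑ m₀ S(m₁) ≡ ∑ ε(S(m₁)) m₀ = m. This gives
surjectivity of `sigma`. -/
theorem actAntipode_coact_sub_mem (M : RightHopfModule.{w} k B) {S : B →ₗ[k] B}
    (hS : IsRightAntipode k S) (m : M.carrier) :
    M.actAntipode S (M.coact m) - m ∈ M.actAugmentation := by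
  have h₃ : M.actAugmentation.mkQ ∘ₗ M.actAntipode S = M.actAugmentation.mkQ ∘ₗ
      (TensorProduct.rid k M.carrier).toLinearMap ∘ₗ Coalgebra.counit.lTensor M.carrier := by
    refine TensorProduct.ext' fun n b => ?_
    have h₄ := M.act_sub_counit_smul_mem n (S b)
    rw [hS.counit_apply] at h₄
    simpa using (Submodule.Quotient.eq _).2 h₄
  have h₅ := LinearMap.congr_fun h₃ (M.coact m)
  simp only [LinearMap.comp_apply, LinearEquiv.coe_coe, M.coact_counit] at h₅
  exact (Submodule.Quotient.eq _).1 h₅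

theorem isIso_sigma_of_isRightAntipode {S : B →ₗ[k] B} (hS : IsRightAntipode k S)
    (hm : IsAntiMultiplicative k S) (hc : IsAntiComultiplicative k S) :
    IsIso (sigma.{w} k B) := by
  rw [NatTrans.isIso_iff_isIso_app]
  intro M
  rw [ConcreteCategory.isIso_iff_bijective]
  constructor
  · refine (injective_iff_map_eq_zero _).2 fun (m : M.coinvariants) hm₀ => ?_
    have h₁ : (m : M.carrier) ∈ M.actAugmentation := (Submodule.Quotient.mk_eq_zero _).1 hm₀
    have h₂ : M.actAugmentation ≤ LinearMap.ker (M.actAntipode S ∘ₗ M.coact) :=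
      Submodule.map₂_le.2 fun n _ b hb => by
        rw [LinearMap.mem_ker, LinearMap.comp_apply,
          M.actAntipode_coact_act (hS.mulAntipodeMul_comul hm), LinearMap.mem_ker.1 hb, zero_smul]
    have h₃ := h₂ h₁
    rw [LinearMap.mem_ker, LinearMap.comp_apply,
      M.actAntipode_coact_of_mem_coinvariants hS.map_one m.2] at h₃
    exact Subtype.ext h₃
  · intro q
    obtain ⟨m, rfl⟩ := Submodule.mkQ_surjective _ q
    exact ⟨⟨_, M.actAntipode_coact_mem_coinvariants (hS.antipodeTwist_comul hc) m⟩,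
      (Submodule.Quotient.eq _).2 (M.actAntipode_coact_sub_mem hS m)⟩

/-! ### Natural projections and cofree Hopf modules -/

variable (k B) in
/-- A natural family of projections `M → M^{co B}` that factor through `M / M B⁺`. -/
structure CoinvariantProjection where
  toLin : ∀ M : RightHopfModule.{v} k B, M.carrier →ₗ[k] M.carrier
  mem_coinvariants : ∀ M m, toLin M m ∈ M.coinvariants
  map_act : ∀ M m b, toLin M (M.act m b) = Coalgebra.counit (R := k) b • toLin M m
  naturality : ∀ {M N : RightHopfModule.{v} k B} (f : M ⟶ N) m, f.toLin (toLin M m) = toLin N (f.toLin m)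
  apply_of_mem : ∀ M, ∀ m ∈ M.coinvariants, toLin M m = m

section Cofree

variable {N : Type v} [AddCommGroup N] [Module k N] {act : N →ₗ[k] B →ₗ[k] N}
  {act_one : ∀ n, act n 1 = n} {act_mul : ∀ n a b, act n (a * b) = act (act n a) b}

theorem cofree_act_tmul (n : N) (b c : B) :
    (cofree N act act_one act_mul).act (n ⊗ₜ[k] b) c =
      TensorProduct.map (act n) (LinearMap.mulLeft k b) (Coalgebra.comul c) := rfl

theorem cofree_coact_tmul (n : N) (b : B) :
    (cofree N act act_one act_mul).coact (n ⊗ₜ[k] b) =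
      (TensorProduct.assoc k N B B).symm (n ⊗ₜ[k] Coalgebra.comul b) := rfl

variable (k B N) in
/-- The map `N ⊗ B → N`, `n ⊗ b ↦ ε(b) n`. -/
def tensorCounit : N ⊗[k] B →ₗ[k] N :=
  (TensorProduct.rid k N).toLinearMap ∘ₗ Coalgebra.counit.lTensor N

@[simp]
theorem tensorCounit_tmul (n : N) (b : B) :
    tensorCounit k B N (n ⊗ₜ[k] b) = Coalgebra.counit (R := k) b • n := by
  simp [tensorCounit]

theorem tmul_one_mem_coinvariants_cofree (n : N) :
    n ⊗ₜ[k] (1 : B) ∈ (cofree N act act_one act_mul).coinvariants := by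
  refine ((cofree N act act_one act_mul).mem_coinvariants _).2 ?_
  rw [cofree_coact_tmul, Bialgebra.comul_one, Algebra.TensorProduct.one_def]
  rfl

/-- Apply ε to the middle factor of ρ(x) = x ⊗ 1; the counit law turns the left side back into `x`.
-/
theorem eq_tmul_one_of_mem_coinvariants_cofree {x : N ⊗[k] B}
    (hx : x ∈ (cofree N act act_one act_mul).coinvariants) :
    tensorCounit k B N x ⊗ₜ[k] (1 : B) = x := by
  have h₁ := congrArg ((tensorCounit k B N).rTensor B)
    (((cofree N act act_one act_mul).mem_coinvariants x).1 hx)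
  have h₂ : (tensorCounit k B N).rTensor B ∘ₗ (cofree N act act_one act_mul).coact =
      LinearMap.id := by
    refine TensorProduct.ext' fun n b => ?_
    rw [LinearMap.comp_apply, cofree_coact_tmul]
    have h₃ := congrArg (fun t => n ⊗ₜ[k] TensorProduct.lid k B t)
      (Coalgebra.rTensor_counit_comul (R := k) b)
    refine Eq.trans ?_ (h₃.trans (by simp))
    generalize Coalgebra.comul (R := k) b = t
    induction t with
    | zero => simp
    | add s t hs ht => simp only [map_add, TensorProduct.tmul_add, hs, ht]
    | tmul x y => simp [TensorProduct.smul_tmul]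
  have h₄ := LinearMap.congr_fun h₂ x
  exact h₁.symm.trans h₄

variable {N' : Type v} [AddCommGroup N'] [Module k N'] {act' : N' →ₗ[k] B →ₗ[k] N'}
  {act_one' : ∀ n, act' n 1 = n} {act_mul' : ∀ n a b, act' n (a * b) = act' (act' n a) b}

/-- The morphism `f ⊗ B : N ⊗ B ⟶ N' ⊗ B` induced by a morphism of right `B`-modules. -/
def cofreeMap (f : N →ₗ[k] N') (hf : ∀ n b, f (act n b) = act' (f n) b) :
    cofree N act act_one act_mul ⟶ cofree N' act' act_one' act_mul' where
  toLin := f.rTensor B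
  map_act m c := by
    change N ⊗[k] B at m
    induction m with
    | zero => simp
    | add x y hx hy => simp only [map_add, LinearMap.add_apply, hx, hy]
    | tmul n b =>
      rw [LinearMap.rTensor_tmul, cofree_act_tmul, cofree_act_tmul]
      generalize Coalgebra.comul (R := k) c = t
      induction t with
      | zero => simp
      | add s t hs ht => simp only [map_add, hs, ht]
      | tmul x y => simp [hf]
  map_coact m := by
    change N ⊗[k] B at m
    induction m with
    | zero => simp
    | add x y hx hy => simp only [map_add, hx, hy]
    | tmul n b =>
      rw [LinearMap.rTensor_tmul, cofree_coact_tmul, cofree_coact_tmul]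
      generalize Coalgebra.comul (R := k) b = t
      induction t with
      | zero => simp
      | add s t hs ht => simp only [map_add, TensorProduct.tmul_add, hs, ht]
      | tmul x y => simp

end Cofree

/-- The coaction as a morphism of Hopf modules `M ⟶ M ⊗ B`. -/
def coactHom (M : RightHopfModule.{v} k B) :
    M ⟶ cofree M.carrier M.act M.act_one M.act_mul where
  toLin := M.coact
  map_act := M.coact_act
  map_coact m := (LinearEquiv.symm_apply_eq _).2 (M.coact_coassoc m).symm

variable (k B) in
/-- The Hopf module `B ⊗ B` with `(a ⊗ b) c = ∑ a c₁ ⊗ b c₂` and coaction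
`a ⊗ b ↦ ∑ a ⊗ b₁ ⊗ b₂`. -/
abbrev diagonal : RightHopfModule.{v} k B :=
  cofree B (LinearMap.mul k B) mul_one fun n a b => (mul_assoc n a b).symm

/-! ### Recovering the antipode from a natural projection -/

namespace CoinvariantProjection

variable (T : CoinvariantProjection k B)

/-- The map `S` with `T (1 ⊗ b) = S(b) ⊗ 1` in `diagonal k B`. -/
def antipode : B →ₗ[k] B :=
  tensorCounit k B B ∘ₗ T.toLin (diagonal k B) ∘ₗ TensorProduct.mk k B B 1

/-- The `B`-linear map a ↦ n a from `B` to `N` induces a morphism from `diagonal k B` sending 1 ⊗ b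
to n ⊗ b, so naturality reduces everything to the definition of `antipode`. -/
theorem tensorCounit_toLin_cofree {N : Type v} [AddCommGroup N] [Module k N]
    {act : N →ₗ[k] B →ₗ[k] N} {act_one : ∀ n, act n 1 = n}
    {act_mul : ∀ n a b, act n (a * b) = act (act n a) b} (x : N ⊗[k] B) :
    tensorCounit k B N (T.toLin (cofree N act act_one act_mul) x) =
      TensorProduct.lift (act.compl₂ T.antipode) x := by
  refine LinearMap.congr_fun (TensorProduct.ext' fun n b => ?_ :
    tensorCounit k B N ∘ₗ T.toLin (cofree N act act_one act_mul) = _) x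
  have h := T.naturality (cofreeMap (act := LinearMap.mul k B) (act_one := mul_one)
    (act_mul := fun n a b => (mul_assoc n a b).symm) (act_one' := act_one)
    (act_mul' := act_mul) (act n) (act_mul n)) (1 ⊗ₜ[k] b : B ⊗[k] B)
  have h₁ : (act n).rTensor B ((1 : B) ⊗ₜ[k] b) = n ⊗ₜ[k] b := by simp [act_one]
  have h₂ : tensorCounit k B N ∘ₗ (act n).rTensor B = act n ∘ₗ tensorCounit k B B :=
    TensorProduct.ext' fun x y => by simp
  have h₃ := LinearMap.congr_fun h₂ (T.toLin (diagonal k B) ((1 : B) ⊗ₜ[k] b))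
  refine Eq.trans ?_ h₃
  refine congrArg (tensorCounit k B N) (Eq.trans ?_ h.symm)
  exact congrArg _ h₁.symm

/-- Naturality along the coaction M ⟶ M ⊗ B moves the computation to a cofree module; coinvariance
of T(m) makes ρ(T(m)) = T(m) ⊗ 1, from which ε recovers T(m). -/
theorem toLin_apply (M : RightHopfModule.{v} k B) (m : M.carrier) :
    T.toLin M m = M.actAntipode T.antipode (M.coact m) := by
  have h := congrArg (tensorCounit k B M.carrier) (T.naturality M.coactHom m)
  have h₁ := (M.mem_coinvariants _).1 (T.mem_coinvariants M m)
  refine Eq.trans ?_ (h.trans (T.tensorCounit_toLin_cofree _))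
  refine Eq.trans ?_ (congrArg _ h₁.symm)
  simp

theorem antipode_one : T.antipode 1 = 1 := by
  have h := T.apply_of_mem (diagonal k B) _ (tmul_one_mem_coinvariants_cofree (1 : B))
  exact (congrArg (tensorCounit k B B) h).trans (by simp)

theorem mulAntipodeMul_comul (b c : B) :
    mulAntipodeMul T.antipode b (Coalgebra.comul (R := k) c) =
      Coalgebra.counit (R := k) c • T.antipode b := by
  have h := congrArg (tensorCounit k B B) (T.map_act (diagonal k B) ((1 : B) ⊗ₜ[k] b) c)
  have h₁ : TensorProduct.lift ((LinearMap.mul k B).compl₂ T.antipode) ∘ₗ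
      TensorProduct.map (LinearMap.mul k B 1) (LinearMap.mulLeft k b) =
        mulAntipodeMul T.antipode b := TensorProduct.ext' fun x y => by simp
  rw [← h₁, LinearMap.comp_apply]
  refine ((T.tensorCounit_toLin_cofree _).symm.trans h).trans ?_
  rw [map_smul]
  rfl

theorem antipodeTwist_comul (b : B) :
    antipodeTwist T.antipode (Coalgebra.comul (R := k) b) = T.antipode b ⊗ₜ[k] 1 := by
  -- Here T(b ⊗ 1) = ∑ b₁ ⊗ S(b₂). Its coinvariance reads ∑ b₁ ⊗ S(b₃)₁ ⊗ b₂ S(b₃)₂ = ∑ b₁ ⊗ S(b₂) ⊗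
  -- 1, and ε on the first factor (the map `F`) leaves (B).
  have h₀ := T.mem_coinvariants (codiagonal k B) (b ⊗ₜ[k] (1 : B))
  have h₁ : (codiagonal k B).actAntipode T.antipode ((codiagonal k B).coact (b ⊗ₜ[k] (1 : B))) =
      T.antipode.lTensor B (Coalgebra.comul b) := by
    change TensorProduct.lift ((codiagonal k B).act.compl₂ T.antipode)
      (TensorProduct.map₂ (TensorProduct.mk k B B) (LinearMap.mul k B)
        (Coalgebra.comul b) (Coalgebra.comul (R := k) 1)) = _
    rw [Bialgebra.comul_one, Algebra.TensorProduct.one_def]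
    generalize Coalgebra.comul (R := k) b = t
    induction t with
    | zero => simp
    | add s t hs ht => simp only [map_add, LinearMap.add_apply, hs, ht]
    | tmul x y => simp [codiagonal]
  rw [toLin_apply, h₁] at h₀
  replace h₀ := ((codiagonal k B).mem_coinvariants _).1 h₀
  let F : (B ⊗[k] B) ⊗[k] B →ₗ[k] B ⊗[k] B :=
    ((TensorProduct.lid k B).toLinearMap ∘ₗ Coalgebra.counit.rTensor B).rTensor B
  have h₂ : F ∘ₗ (codiagonal k B).coact ∘ₗ T.antipode.lTensor B = antipodeTwist T.antipode := by
    refine TensorProduct.ext' fun x y => ?_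
    change F (TensorProduct.map₂ (TensorProduct.mk k B B) (LinearMap.mul k B)
      (Coalgebra.comul x) (Coalgebra.comul (T.antipode y))) = _
    rw [antipodeTwist_tmul]
    generalize Coalgebra.comul (R := k) (T.antipode y) = t
    induction t with
    | zero => simp
    | add s t hs ht => simp only [map_add, hs, ht]
    | tmul u w =>
      have h₃ := congrArg (fun t => u ⊗ₜ[k] (TensorProduct.lid k B t * w))
        (Coalgebra.rTensor_counit_comul (R := k) x)
      refine Eq.trans ?_ (h₃.trans (by simp))
      generalize Coalgebra.comul (R := k) x = t
      induction t with
      | zero => simp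
      | add s t hs ht =>
        simp only [map_add, LinearMap.add_apply, add_mul, TensorProduct.tmul_add, hs, ht]
      | tmul x y => simp [F, TensorProduct.smul_tmul]
  have h₃ := LinearMap.congr_fun h₂ (Coalgebra.comul b)
  rw [← h₃]
  refine (congrArg F h₀).trans ?_
  have h₄ := congrArg (fun t => T.antipode (TensorProduct.lid k B t) ⊗ₜ[k] (1 : B))
    (Coalgebra.rTensor_counit_comul (R := k) b)
  refine Eq.trans ?_ (h₄.trans (by simp))
  generalize Coalgebra.comul (R := k) b = t
  induction t with
  | zero => simp
  | add s t hs ht => simp only [map_add, TensorProduct.add_tmul, hs, ht]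
  | tmul x y => simp [F]

theorem exists_antipode (T : CoinvariantProjection k B) : ∃ S : B →ₗ[k] B,
    IsRightAntipode k S ∧ IsAntiMultiplicative k S ∧ IsAntiComultiplicative k S := by
  have hS := isRightAntipode_of_mulAntipodeMul T.antipode_one T.mulAntipodeMul_comul
  exact ⟨T.antipode, hS,
    isAntiMultiplicative_of_antipodeTwist hS T.mulAntipodeMul_comul T.antipodeTwist_comul,
    isAntiComultiplicative_of_antipodeTwist hS T.mulAntipodeMul_comul T.antipodeTwist_comul⟩

/-! ### From a natural projection to semiseparability -/

/-- The morphism `M ⟶ N`, `m ↦ ∑ g(T(m₀)) m₁`. -/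
def extend {M N : RightHopfModule.{v} k B} (g : M.coinvariants →ₗ[k] N.coinvariants) : M ⟶ N where
  toLin := TensorProduct.lift N.act ∘ₗ (N.coinvariants.subtype ∘ₗ g ∘ₗ
    (T.toLin M).codRestrict M.coinvariants (T.mem_coinvariants M)).rTensor B ∘ₗ M.coact
  map_act m b := by
    -- T absorbs b₁ as ε(b₁), so the counit law leaves `b` acting on the right.
    have hact : ∀ n c, (T.toLin M).codRestrict M.coinvariants (T.mem_coinvariants M)
        (M.act n c) = Coalgebra.counit (R := k) c •
          (T.toLin M).codRestrict M.coinvariants (T.mem_coinvariants M) n :=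
      fun n c => Subtype.ext (T.map_act M n c)
    simp only [LinearMap.comp_apply, M.coact_act]
    generalize M.coact m = t
    induction t with
    | zero => simp
    | add s t hs ht => simp only [map_add, LinearMap.add_apply, hs, ht]
    | tmul n c =>
      have h := congrArg (fun t => N.act (g ((T.toLin M).codRestrict M.coinvariants
        (T.mem_coinvariants M) n)) (c * TensorProduct.lid k B t))
        (Coalgebra.rTensor_counit_comul (R := k) b)
      refine Eq.trans ?_ (h.trans (by simp [N.act_mul]))
      generalize Coalgebra.comul (R := k) b = t
      induction t with
      | zero => simp
      | add s t hs ht => simp only [map_add, mul_add, hs, ht]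
      | tmul x y => simp [hact]
  map_coact m := by
    let f : M.carrier →ₗ[k] N.carrier := N.coinvariants.subtype ∘ₗ g ∘ₗ
      (T.toLin M).codRestrict M.coinvariants (T.mem_coinvariants M)
    have hf : ∀ n, N.coact (f n) = f n ⊗ₜ[k] 1 := fun n => (g _).2
    have h₁ : N.coact ∘ₗ TensorProduct.lift N.act ∘ₗ f.rTensor B =
        (TensorProduct.lift N.act ∘ₗ f.rTensor B).rTensor B ∘ₗ
          (TensorProduct.assoc k M.carrier B B).symm.toLinearMap ∘ₗ
            Coalgebra.comul.lTensor M.carrier := by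
      refine TensorProduct.ext' fun n b => ?_
      simp only [LinearMap.comp_apply, LinearMap.rTensor_tmul, TensorProduct.lift.tmul,
        N.coact_act, hf, LinearMap.lTensor_tmul, LinearEquiv.coe_coe]
      generalize Coalgebra.comul (R := k) b = t
      induction t with
      | zero => simp
      | add s t hs ht => simp only [map_add, TensorProduct.tmul_add, hs, ht]
      | tmul x y => simp
    have h₂ := (LinearEquiv.eq_symm_apply _).2 (M.coact_coassoc m)
    have h₃ := LinearMap.congr_fun h₁ (M.coact m)
    refine h₃.trans ?_
    simp only [LinearMap.comp_apply, LinearEquiv.coe_coe, ← h₂]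
    rw [← LinearMap.comp_apply, ← LinearMap.rTensor_comp]
    rfl

theorem extend_apply {M N : RightHopfModule.{v} k B} (g : M.coinvariants →ₗ[k] N.coinvariants)
    (m : M.carrier) : (T.extend g).toLin m = TensorProduct.lift N.act ((N.coinvariants.subtype ∘ₗ
      g ∘ₗ (T.toLin M).codRestrict M.coinvariants (T.mem_coinvariants M)).rTensor B
        (M.coact m)) := rfl

theorem extend_coe {M N : RightHopfModule.{v} k B} (g : M.coinvariants →ₗ[k] N.coinvariants)
    (m : M.coinvariants) : (T.extend g).toLin (m : M.carrier) = g m := by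
  rw [extend_apply, (M.mem_coinvariants _).1 m.2]
  have h : (T.toLin M).codRestrict M.coinvariants (T.mem_coinvariants M) m = m :=
    Subtype.ext (T.apply_of_mem M m m.2)
  simp [h, N.act_one]

theorem extend_comp {X X' Y Y' : RightHopfModule.{v} k B} (f : X' ⟶ X)
    (g : X.coinvariants →ₗ[k] Y.coinvariants) (h : Y ⟶ Y') :
    T.extend (h.toLin.restrict (Hom.mem_coinvariants h) ∘ₗ g ∘ₗ
      f.toLin.restrict (Hom.mem_coinvariants f)) = f ≫ T.extend g ≫ h := by
  ext m
  rw [comp_toLin, comp_toLin, LinearMap.comp_apply, LinearMap.comp_apply, extend_apply,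
    extend_apply, f.map_coact]
  generalize X'.coact m = t
  induction t with
  | zero => simp
  | add s t hs ht => simp only [map_add, hs, ht]
  | tmul n b =>
    simp only [LinearMap.rTensor_tmul, TensorProduct.lift.tmul, h.map_act]
    have h₁ : (T.toLin X).codRestrict X.coinvariants (T.mem_coinvariants X) (f.toLin n) =
        f.toLin.restrict (Hom.mem_coinvariants f)
          ((T.toLin X').codRestrict X'.coinvariants (T.mem_coinvariants X') n) :=
      Subtype.ext (T.naturality f n).symm
    simp only [LinearMap.comp_apply, h₁]
    rfl

theorem isSemiseparable (T : CoinvariantProjection k B) :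
    (coinvariantsFunctor.{v} k B).IsSemiseparable := by
  refine ⟨fun X Y g => T.extend (M := X) (N := Y) g.hom,
    fun f g h => T.extend_comp f g.hom h, ?_⟩
  intro X Y f
  ext m
  exact Subtype.ext (T.extend_coe _ m)

end CoinvariantProjection

/-! ### Projections from a retraction and from semiseparability -/

/-- A retraction of `sigma` gives a family of projections onto the coinvariants. -/
def coinvariantProjectionOfRetraction (τ : quotientFunctor.{v} k B ⟶ coinvariantsFunctor.{v} k B)
    (h : sigma.{v} k B ≫ τ = 𝟙 _) : CoinvariantProjection k B where
  toLin M := M.coinvariants.subtype ∘ₗ (τ.app M).hom ∘ₗ M.actAugmentation.mkQ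
  mem_coinvariants M m := ((τ.app M).hom _).2
  map_act M m b := by
    have h₁ : M.actAugmentation.mkQ (M.act m b) =
        Coalgebra.counit (R := k) b • M.actAugmentation.mkQ m :=
      (Submodule.Quotient.eq _).2 (M.act_sub_counit_smul_mem m b)
    exact (congrArg (fun q => ((τ.app M).hom q : M.coinvariants).1) h₁).trans
      (congrArg Subtype.val (map_smul (τ.app M).hom _ _))
  naturality {M N} f m :=
    (congrArg N.coinvariants.subtype
      (LinearMap.congr_fun (congrArg ModuleCat.Hom.hom (τ.naturality f))
        (M.actAugmentation.mkQ m))).symm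
  apply_of_mem M m hm :=
    congrArg M.coinvariants.subtype (LinearMap.congr_fun
      (congrArg ModuleCat.Hom.hom (NatTrans.congr_app h M)) ⟨m, hm⟩)

variable (k B) in
/-- The Hopf module `V ⊗ B` with the action and coaction of the right factor. -/
abbrev free (V : Type v) [AddCommGroup V] [Module k V] : RightHopfModule.{v} k B :=
  cofree V (LinearMap.lsmul k V |>.flip.compl₂ Coalgebra.counit) (by simp)
    (by simp [smul_smul])

/-- `V` carries the trivial action through ε, so the diagonal action ∑ x ε(c₁) ⊗ b c₂ only touches
the right factor. -/
theorem free_act_tmul {V : Type v} [AddCommGroup V] [Module k V] (x : V) (b c : B) :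
    (free k B V).act (x ⊗ₜ[k] b) c = x ⊗ₜ[k] (b * c) := by
  rw [cofree_act_tmul]
  have h := congrArg (fun t => x ⊗ₜ[k] (b * TensorProduct.lid k B t))
    (Coalgebra.rTensor_counit_comul (R := k) c)
  refine Eq.trans ?_ (h.trans (by simp))
  generalize Coalgebra.comul (R := k) c = t
  induction t with
  | zero => simp
  | add s t hs ht => simp only [map_add, mul_add, TensorProduct.tmul_add, hs, ht]
  | tmul x y => simp [TensorProduct.smul_tmul]

theorem free_act {V : Type v} [AddCommGroup V] [Module k V] (x : V ⊗[k] B) (c : B) :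
    (free k B V).act x c = (LinearMap.mulRight k c).lTensor V x := by
  induction x with
  | zero => simp
  | add s t hs ht => rw [map_add, LinearMap.add_apply, hs, ht, map_add]
  | tmul x b => rw [free_act_tmul]; simp

/-- The morphism `M^{co B} ⊗ B ⟶ M` given by the action. -/
def freeCoinvariants (M : RightHopfModule.{v} k B) : free k B M.coinvariants ⟶ M where
  toLin := TensorProduct.lift (M.act ∘ₗ M.coinvariants.subtype)
  map_act x c := by
    change M.coinvariants ⊗[k] B at x
    rw [free_act]
    induction x with
    | zero => simp
    | add s t hs ht => simp only [map_add, LinearMap.add_apply, hs, ht]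
    | tmul x b => simp [M.act_mul]
  map_coact x := by
    change M.coinvariants ⊗[k] B at x
    induction x with
    | zero => simp
    | add s t hs ht => simp only [map_add, hs, ht]
    | tmul x b =>
      rw [cofree_coact_tmul]
      simp only [TensorProduct.lift.tmul, LinearMap.comp_apply, M.coact_act,
        Submodule.subtype_apply, (M.mem_coinvariants _).1 x.2]
      generalize Coalgebra.comul (R := k) b = t
      induction t with
      | zero => simp
      | add s t hs ht => simp only [map_add, TensorProduct.tmul_add, hs, ht]
      | tmul y z => simp

/-- The map `M^{co B} → (M^{co B} ⊗ B)^{co B}`, `m ↦ m ⊗ 1`. -/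
def toFreeCoinvariants (M : RightHopfModule.{v} k B) :
    (coinvariantsFunctor.{v} k B).obj M ⟶
      (coinvariantsFunctor.{v} k B).obj (free k B M.coinvariants) :=
  ModuleCat.ofHom (((TensorProduct.mk k M.coinvariants B).flip 1).codRestrict
    (free k B M.coinvariants).coinvariants fun m => tmul_one_mem_coinvariants_cofree m)

/-- `P` lifts m ↦ m ⊗ 1 to γ : M ⟶ M^{co B} ⊗ B even though that map need not come from a morphism;
the regularity of `P` is needed only to see that γ(m) = m ⊗ 1 for coinvariant m. -/
theorem nonempty_coinvariantProjection_of_isSemiseparable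
    (h : (coinvariantsFunctor.{v} k B).IsSemiseparable) :
    Nonempty (CoinvariantProjection k B) := by
  obtain ⟨P, hP, hF⟩ := h
  let γ (M : RightHopfModule.{v} k B) : M ⟶ free k B M.coinvariants :=
    P _ _ (toFreeCoinvariants M)
  refine ⟨{
    toLin := fun M => M.coinvariants.subtype ∘ₗ tensorCounit k B M.coinvariants ∘ₗ (γ M).toLin
    mem_coinvariants := fun M m => (tensorCounit k B M.coinvariants ((γ M).toLin m)).2
    map_act := fun M m b => ?_
    naturality := fun {M N} f m => ?_
    apply_of_mem := fun M m hm => ?_ }⟩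
  · simp only [LinearMap.comp_apply]
    rw [(γ M).map_act, free_act]
    have h₁ : tensorCounit k B M.coinvariants ∘ₗ
        (LinearMap.mulRight k b).lTensor M.coinvariants =
          Coalgebra.counit (R := k) b • tensorCounit k B M.coinvariants :=
      TensorProduct.ext' fun x y => by simp [mul_comm, mul_smul]
    rw [← map_smul]
    exact congrArg _ (LinearMap.congr_fun h₁ ((γ M).toLin m))
  · let f₀ : M.coinvariants →ₗ[k] N.coinvariants := f.toLin.restrict (Hom.mem_coinvariants f)
    let f₁ : free k B M.coinvariants ⟶ free k B N.coinvariants :=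
      cofreeMap f₀ fun n b => by simp
    -- Both sides are `P` of the same map m ↦ f(m) ⊗ 1, by naturality of `P` in each variable.
    have h₁ : f ≫ γ N = γ M ≫ f₁ := by
      have h₂ := hP f (toFreeCoinvariants N) (𝟙 _)
      have h₃ := hP (𝟙 _) (toFreeCoinvariants M) f₁
      simp only [CategoryTheory.Functor.map_id, Category.comp_id, Category.id_comp] at h₂ h₃
      rw [← h₂, ← h₃]
      congr 1
    have h₄ := LinearMap.congr_fun (congrArg Hom.toLin h₁) m
    have h₅ : tensorCounit k B N.coinvariants ∘ₗ f₀.rTensor B =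
        f₀ ∘ₗ tensorCounit k B M.coinvariants := TensorProduct.ext' fun x y => by simp
    have h₆ := LinearMap.congr_fun h₅ ((γ M).toLin m)
    refine congrArg Subtype.val (h₆.symm.trans ?_)
    exact congrArg (tensorCounit k B N.coinvariants) h₄.symm
  · have h₁ : (coinvariantsFunctor.{v} k B).map (freeCoinvariants M) ≫ toFreeCoinvariants M =
        𝟙 _ := by
      ext x
      obtain ⟨x, hx⟩ := x
      refine Subtype.ext ?_
      have h₂ := eq_tmul_one_of_mem_coinvariants_cofree hx
      change (⟨(freeCoinvariants M).toLin x, Hom.mem_coinvariants _ x hx⟩ :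
        M.coinvariants) ⊗ₜ[k] (1 : B) = x
      refine (congrArg (· ⊗ₜ[k] (1 : B)) (Subtype.ext ?_)).trans h₂
      refine (congrArg (freeCoinvariants M).toLin h₂.symm).trans ?_
      simp [freeCoinvariants, M.act_one]
    -- By `h₁`, `freeCoinvariants M` followed by γ is `P` of an identity, and regularity at that
    -- identity makes this composite fix every coinvariant m ⊗ 1.
    have h₂ := hP (freeCoinvariants M) (toFreeCoinvariants M) (𝟙 _)
    have h₃ := hF (𝟙 (free k B M.coinvariants))
    simp only [CategoryTheory.Functor.map_id, Category.comp_id, h₁] at h₂ h₃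
    have h₄ := LinearMap.congr_fun (congrArg ModuleCat.Hom.hom h₃)
      (toFreeCoinvariants M ⟨m, hm⟩)
    rw [h₂] at h₄
    have h₅ : (γ M).toLin ((freeCoinvariants M).toLin ((⟨m, hm⟩ : M.coinvariants) ⊗ₜ[k] (1 : B))) =
      (⟨m, hm⟩ : M.coinvariants) ⊗ₜ[k] (1 : B) := congrArg Subtype.val h₄
    have h₆ : (freeCoinvariants M).toLin ((⟨m, hm⟩ : M.coinvariants) ⊗ₜ[k] (1 : B)) = m := by
      simp [freeCoinvariants, M.act_one]
    rw [h₆] at h₅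
    simp only [LinearMap.comp_apply]
    rw [h₅]
    simp

end RightHopfModule

end

theorem mainTheorem12 (k : Type u) [Field k] (B : Type v) [Ring B] [Bialgebra k B] :
    List.TFAE
      [(RightHopfModule.coinvariantsFunctor.{v} k B).IsSemiseparable,
       ∃ S : B →ₗ[k] B,
        IsRightAntipode k S ∧ IsAntiMultiplicative k S ∧ IsAntiComultiplicative k S,
       IsIso (RightHopfModule.sigma.{v} k B),
       IsSplitMono (RightHopfModule.sigma.{v} k B)] := by
  tfae_have 1 → 2 := fun h =>
    (RightHopfModule.nonempty_coinvariantProjection_of_isSemiseparable h).elim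
      RightHopfModule.CoinvariantProjection.exists_antipode
  tfae_have 2 → 3 := fun ⟨_, hS, hm, hc⟩ =>
    RightHopfModule.isIso_sigma_of_isRightAntipode hS hm hc
  tfae_have 3 → 4 := fun _ => inferInstance
  tfae_have 4 → 1 := fun _ =>
    (RightHopfModule.coinvariantProjectionOfRetraction _
      (IsSplitMono.id (RightHopfModule.sigma.{v} k B))).isSemiseparable
  tfae_finish
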